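/- **Conventions.** Fix a real number $q>0$. Put $[i]=\sum_{k=0}^{i-1}q^k$, $[k]!=\prod_{i=1}^k[i]$, $\genfrac{[}{]}{0pt}{}{N}{k}=\frac{[N]!}{[k]!\,[N-k]!}$ for $0\le k\le N$ and $(t;q)_N=\prod_{i=0}^{N-1}(1-tq^i)$. For a tuple $c=(c_1,\dots,c_s)$ of nonnegative integers ($c_i$ balls at site $i$), $\mathrm{MSet}(c)$ is the multiset containing $c_i$ times each $i\in\{1,\dots,s\}$; $0^i$ denotes $i$ consecutive zeros. A *configuration* is a tuple $c=(c_1,\dots,c_n)$, $n\ge 1$, of nonnegative integers with $\sum_i c_i=n$. The balls of a configuration $c$ are dropped one at a time onto $\mathbb Z$, initially empty: a ball dropped on an occupied site moves one site left with probability $q/(1+q)$ and one site right with probability $1/(1+q)$, and repeats this until it arrives at an empty site, where it stays. The probability $\mathbb P(c\to[1;n])_q$ that the final set of occupied sites is $\{1,\dots,n\}$ does not depend on the order in which the balls are dropped. The *remixed Eulerian number* is $A_c(q)=[n]!\,\mathbb P(c\to[1;n])_q$. Every configuration is uniquely of the form $(0^i,\gamma,0^k)$ with $\gamma$ nonempty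 and with positive first and last entries; $\gamma$ is its *core*. For a core $\gamma$ with $n$ balls on $s$ sites (so $s\le n$) the *corrective series* is the power series in $t$ $$P_\gamma(q,t)=(t;q)_{n+1}\sum_{j\ge 0}t^j\prod_{a\in\mathrm{MSet}(\gamma)}[j+a]\;-\;\sum_{i=0}^{n-s}t^iA_{(0^i,\gamma,0^{n-s-i})}(q).$$ **Theorem (one-hole configurations).** Let $\gamma$ be the core of a configuration, and suppose that $\gamma$ has exactly one empty site, so that $\gamma=(\alpha,0,\beta)$, where $\alpha$ has $p$ balls on $\ell$ sites, $\beta$ has $r$ balls on $m$ sites, and all entries of $\alpha$ and $\beta$ are positive. Let $n=p+r$. Then $$P_\gamma(q,t)=t^{p-\ell}\Bigl(\prod_{a\in\mathrm{MSet}(\alpha)}[\ell+1-a]\,q^{a-\ell}\Bigr)\Bigl(\prod_{b\in\mathrm{MSet}(\beta)}[b]\Bigr)\sum_{i=0}^{r}(-1)^it^i\,q^{\binom p2+pi+\binom{i+1}2}\genfrac{[}{]}{0pt}{}{n+1}{r-i},$$ and for all $i\in\{0,\dots,n-\ell-m-1\}$ $$A_{(0^i,\gamma,0^{n-\ell-m-1-i})}(q)=\sum_{j=0}^{i}(-1)^{i+j}q^{\binom{i-j}2}\genfrac{[}{]}{0pt}{}{n+1}{i-j}\prod_{a\in\mathrm{MSet}(\gamma)}[j+a]\;+\;\varepsilon_i\,(-1)^{i+p+\ell+1}q^{\binom{i+\ell+1}2-p}\Bigl(\prod_{a\in\mathrm{MSet}(\alpha)}[\ell+1-a]\,q^{a-\ell}\Bigr)\Bigl(\prod_{b\in\mathrm{MSet}(\beta)}[b]\Bigr)\genfrac{[}{]}{0pt}{}{n+1}{i+\ell+1},$$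 where $\varepsilon_i=1$ if $i\ge p-\ell$ and $\varepsilon_i=0$ otherwise. -/

import Mathlib

open scoped PowerSeries

/-! ### `q`-analogs -/

/-- The `q`-integer `[i] = 1 + q + ⋯ + q^(i-1)`. -/
noncomputable def qInt (q : ℝ) (i : ℕ) : ℝ := ∑ k ∈ Finset.range i, q ^ k

/-- The `q`-factorial `[n]! = [1][2]⋯[n]`. -/
noncomputable def qFact (q : ℝ) (n : ℕ) : ℝ := ∏ i ∈ Finset.Icc 1 n, qInt q i

/-- The `q`-binomial coefficient `[n]! / ([k]! [n-k]!)`, which is zero when `n < k`. -/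
noncomputable def qBinom (q : ℝ) (n k : ℕ) : ℝ :=
  if k ≤ n then qFact q n / (qFact q k * qFact q (n - k)) else 0

/-- The `q`-Pochhammer `(t;q)_n = ∏_{i<n} (1 - t q^i)`, as a power series in `t`. -/
noncomputable def qPoch (q : ℝ) (n : ℕ) : ℝ⟦X⟧ :=
  ∏ i ∈ Finset.range n, (1 - PowerSeries.C (q ^ i) * PowerSeries.X)

/-! ### The particle model on `ℤ` -/

/-- `landWithin q S N x y` is the probability that a ball dropped at site `x`, when the occupied
sites are those of `S`, comes to rest at site `y` after at most `N` moves. On an empty site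
the ball rests; on an occupied one it moves one site left with probability `q/(1+q)` and one
site right with probability `1/(1+q)`. -/
noncomputable def landWithin (q : ℝ) (S : Finset ℤ) : ℕ → ℤ → ℤ → ℝ
  | 0, x, y => if x ∉ S ∧ x = y then 1 else 0
  | N + 1, x, y =>
      if x ∈ S then
        q / (1 + q) * landWithin q S N (x - 1) y + 1 / (1 + q) * landWithin q S N (x + 1) y
      else if x = y then 1 else 0

/-- The probability that a ball dropped at `x` comes to rest at `y`: the supremum, which is the
limit, of the nondecreasing sequence of probabilities of doing so within `N` moves. -/
noncomputable def landProb (q : ℝ) (S : Finset ℤ) (x y : ℤ) : ℝ := ⨆ N, landWithin q S N x y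

/-- `finalProb q T u S` is the probability that, when the occupied sites are those of `S` and the
balls of the list `u` are dropped one after the other in the order of the list, the set of
occupied sites at the end is `T`. -/
noncomputable def finalProb (q : ℝ) (T : Finset ℤ) : List ℤ → Finset ℤ → ℝ
  | [], S => if S = T then 1 else 0
  | x :: u, S => ∑' y : ℤ, landProb q S x y * finalProb q T u (insert y S)

/-! ### Configurations -/

/-- The multiset `MSet(c)` of a tuple `c = (c_1, …, c_m)`: it has `c_i` times the element `i`,
sites being numbered from `1`. -/
def mset (c : List ℕ) : Multiset ℕ :=
  ∑ i : Fin c.length, Multiset.replicate (c.get i) (i.val + 1)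

/-- A configuration: a nonempty tuple with as many balls as sites. -/
def IsConfiguration (c : List ℕ) : Prop := c ≠ [] ∧ c.sum = c.length

/-- The left-to-right order of the balls of `c`. -/
def leftToRight (c : List ℕ) : List ℤ := ((mset c).sort (· ≤ ·)).map (fun a : ℕ => (a : ℤ))

/-- The remixed Eulerian number `A_c(q) = [n]! ℙ(c → [1;n])_q`, for a configuration `c` on `n`
sites. The balls are dropped left to right; by `finalProb_perm` below, any other order
gives the same number. -/
noncomputable def remixedEulerian (q : ℝ) (c : List ℕ) : ℝ :=
  qFact q c.length * finalProb q (Finset.Icc 1 (c.length : ℤ)) (leftToRight c) ∅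

/-- `pad i γ k` is the tuple `(0^i, γ, 0^k)`. -/
def pad (i : ℕ) (γ : List ℕ) (k : ℕ) : List ℕ := List.replicate i 0 ++ γ ++ List.replicate k 0

/-- `γ` is the core of `c`: `c = (0^i, γ, 0^k)`, where `γ` is nonempty and its first and last
entries are positive. -/
def IsCore (γ c : List ℕ) : Prop :=
  (∃ i k : ℕ, c = pad i γ k) ∧ (∃ a ∈ γ.head?, 0 < a) ∧ (∃ b ∈ γ.getLast?, 0 < b)

/-- `γ` is the core of some configuration and has exactly one empty site. -/
def IsOneHoleCore (γ : List ℕ) : Prop :=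
  (∃ c, IsConfiguration c ∧ IsCore γ c) ∧ γ.count 0 = 1

/-- The corrective series `P_γ(q,t)` of a core `γ` with `n` balls on `s` sites, `s ≤ n`,
as a power series in `t`:
`(t;q)_{n+1} ∑_{j ≥ 0} t^j ∏_{a ∈ MSet(γ)} [j+a] - ∑_{i=0}^{n-s} t^i A_{(0^i, γ, 0^{n-s-i})}(q)`. -/
noncomputable def correctiveSeries (q : ℝ) (γ : List ℕ) : ℝ⟦X⟧ :=
  qPoch q (γ.sum + 1) *
      PowerSeries.mk (fun j => ((mset γ).map (fun a => qInt q (j + a))).prod)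
    - ∑ i ∈ Finset.range (γ.sum - γ.length + 1),
        PowerSeries.C (remixedEulerian q (pad i γ (γ.sum - γ.length - i))) * PowerSeries.X ^ i

/-! ### Independence of the order in which the balls are dropped -/

theorem landWithin_mem (q : ℝ) (S : Finset ℤ) (N : ℕ) (x y : ℤ) (hx : x ∈ S) :
    landWithin q S (N + 1) x y =
      q / (1 + q) * landWithin q S N (x - 1) y + 1 / (1 + q) * landWithin q S N (x + 1) y := by
  simp [landWithin, hx]

theorem landWithin_notMem (q : ℝ) (S : Finset ℤ) (N : ℕ) (x y : ℤ) (hx : x ∉ S) :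
    landWithin q S N x y = if x = y then 1 else 0 := by
  cases N <;> simp [landWithin, hx]

theorem landWithin_bounds {q : ℝ} (hq : 0 ≤ q) (S : Finset ℤ) (N : ℕ) (x y : ℤ) :
    0 ≤ landWithin q S N x y ∧ landWithin q S N x y ≤ 1 := by
  have h1 : 0 ≤ q / (1 + q) := by positivity
  have h2 : 0 ≤ 1 / (1 + q) := by positivity
  have h3 : q / (1 + q) + 1 / (1 + q) = 1 := by field_simp; ring
  induction N generalizing x with
  | zero => simp only [landWithin]; split_ifs <;> norm_num
  | succ N ih =>
    by_cases hx : x ∈ S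
    · rw [landWithin_mem q S N x y hx]
      obtain ⟨a1, a2⟩ := ih (x - 1)
      obtain ⟨b1, b2⟩ := ih (x + 1)
      constructor
      · positivity
      · nlinarith
    · rw [landWithin_notMem q S _ x y hx]; split_ifs <;> norm_num

theorem landWithin_mono {q : ℝ} (hq : 0 ≤ q) (S : Finset ℤ) (x y : ℤ) :
    Monotone (fun N => landWithin q S N x y) := by
  have h1 : 0 ≤ q / (1 + q) := by positivity
  have h2 : 0 ≤ 1 / (1 + q) := by positivity
  apply monotone_nat_of_le_succ
  intro N
  induction N generalizing x with
  | zero =>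
    by_cases hx : x ∈ S
    · have := (landWithin_bounds hq S 1 x y).1
      simpa [landWithin, hx] using this
    · simp [landWithin_notMem q S _ x y hx]
  | succ N ih =>
    by_cases hx : x ∈ S
    · rw [landWithin_mem q S N x y hx, landWithin_mem q S (N + 1) x y hx]
      have := ih (x - 1)
      have := ih (x + 1)
      gcongr
    · simp [landWithin_notMem q S _ x y hx]

theorem tendsto_landProb {q : ℝ} (hq : 0 ≤ q) (S : Finset ℤ) (x y : ℤ) :
    Filter.Tendsto (fun N => landWithin q S N x y) Filter.atTop (nhds (landProb q S x y)) :=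
  tendsto_atTop_ciSup (landWithin_mono hq S x y)
    ⟨1, by rintro _ ⟨N, rfl⟩; exact (landWithin_bounds hq S N x y).2⟩

theorem landProb_notMem (q : ℝ) (S : Finset ℤ) (x y : ℤ) (hx : x ∉ S) :
    landProb q S x y = if x = y then 1 else 0 := by
  simp [landProb, landWithin_notMem q S _ x y hx]

theorem landProb_mem {q : ℝ} (hq : 0 ≤ q) (S : Finset ℤ) (x y : ℤ) (hx : x ∈ S) :
    landProb q S x y =
      q / (1 + q) * landProb q S (x - 1) y + 1 / (1 + q) * landProb q S (x + 1) y := by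
  have h1 := (tendsto_landProb hq S x y).comp (Filter.tendsto_add_atTop_nat 1)
  have h2 := ((tendsto_landProb hq S (x - 1) y).const_mul (q / (1 + q))).add
    ((tendsto_landProb hq S (x + 1) y).const_mul (1 / (1 + q)))
  refine tendsto_nhds_unique h1 (h2.congr fun N => ?_)
  simp [landWithin_mem q S N x y hx]

theorem landWithin_eq_zero (q : ℝ) (S : Finset ℤ) (N : ℕ) (x y : ℤ)
    (hy : y ∉ insert x (S.image (· + 1) ∪ S.image (· - 1))) : landWithin q S N x y = 0 := by
  have key : ∀ N x, x ≠ y → y ∉ S.image (· + 1) ∪ S.image (· - 1) →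
      landWithin q S N x y = 0 := by
    intro N
    induction N with
    | zero => intro x hxy _; simp [landWithin, hxy]
    | succ N ih =>
      intro x hxy hy
      by_cases hx : x ∈ S
      · have e1 : x - 1 ≠ y := by
          rintro rfl; exact hy (by simp; right; exact hx)
        have e2 : x + 1 ≠ y := by
          rintro rfl; exact hy (by simp; left; exact hx)
        rw [landWithin_mem q S N x y hx, ih _ e1 hy, ih _ e2 hy]; simp
      · simp [landWithin_notMem q S _ x y hx, hxy]
  rw [Finset.mem_insert, not_or] at hy
  exact key N x (Ne.symm hy.1) hy.2

/-- The average of `f` over the set of occupied sites after a ball is dropped at `x`. -/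
noncomputable def dropAvg (q : ℝ) (x : ℤ) (f : Finset ℤ → ℝ) (S : Finset ℤ) : ℝ :=
  ∑' y : ℤ, landProb q S x y * f (insert y S)

theorem dropAvg_eq_sum (q : ℝ) (x : ℤ) (f : Finset ℤ → ℝ) (S : Finset ℤ) (B : Finset ℤ)
    (hB : insert x (S.image (· + 1) ∪ S.image (· - 1)) ⊆ B) :
    dropAvg q x f S = ∑ y ∈ B, landProb q S x y * f (insert y S) := by
  refine tsum_eq_sum fun y hy => ?_
  simp [landProb, landWithin_eq_zero q S _ x y fun h => hy (hB h)]

theorem dropAvg_notMem (q : ℝ) (x : ℤ) (f : Finset ℤ → ℝ) (S : Finset ℤ) (hx : x ∉ S) :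
    dropAvg q x f S = f (insert x S) := by
  unfold dropAvg
  rw [tsum_eq_single x]
  · simp [landProb_notMem q S x x hx]
  · intro y hy; simp [landProb_notMem q S x y hx, Ne.symm hy]

theorem dropAvg_mem {q : ℝ} (hq : 0 ≤ q) (x : ℤ) (f : Finset ℤ → ℝ) (S : Finset ℤ)
    (hx : x ∈ S) :
    dropAvg q x f S =
      q / (1 + q) * dropAvg q (x - 1) f S + 1 / (1 + q) * dropAvg q (x + 1) f S := by
  set A := S.image (· + 1) ∪ S.image (· - 1) with hA
  set B := insert x (insert (x - 1) (insert (x + 1) A)) with hB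
  rw [dropAvg_eq_sum q x f S B (by intro z; simp only [hB, ← hA, Finset.mem_insert]; tauto),
    dropAvg_eq_sum q (x - 1) f S B (by intro z; simp only [hB, ← hA, Finset.mem_insert]; tauto),
    dropAvg_eq_sum q (x + 1) f S B (by intro z; simp only [hB, ← hA, Finset.mem_insert]; tauto),
    Finset.mul_sum, Finset.mul_sum, ← Finset.sum_add_distrib]
  refine Finset.sum_congr rfl fun y _ => ?_
  rw [landProb_mem hq S x y hx]; ring

/-- Maximum principle for the walk on the sites of a finite set. -/
theorem harmonic_le_zero {q : ℝ} (hq : 0 ≤ q) (S : Finset ℤ) (g : ℤ → ℝ)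
    (h0 : ∀ x ∉ S, g x ≤ 0)
    (h1 : ∀ x ∈ S, g x = q / (1 + q) * g (x - 1) + 1 / (1 + q) * g (x + 1)) (x : ℤ) :
    g x ≤ 0 := by
  by_contra! hx
  have hxS : x ∈ S := by by_contra h; exact absurd (h0 x h) (not_le.2 hx)
  obtain ⟨m, hm, hmax⟩ := S.exists_max_image g ⟨x, hxS⟩
  have hpos : 0 < g m := hx.trans_le (hmax x hxS)
  have hall : ∀ z, g z ≤ g m := fun z => by
    by_cases hz : z ∈ S
    · exact hmax z hz
    · exact (h0 z hz).trans hpos.le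
  have hstep : ∀ z, g z = g m → g (z + 1) = g m := by
    intro z hz
    have hzS : z ∈ S := by
      by_contra h; have := h0 z h; linarith
    have e := h1 z hzS
    have hq1 : (0 : ℝ) < 1 + q := by positivity
    field_simp at e
    have a1 := hall (z - 1)
    have a2 := hall (z + 1)
    nlinarith [mul_nonneg hq (sub_nonneg.2 a1)]
  have hev : ∀ k : ℕ, g (m + k) = g m := by
    intro k
    induction k with
    | zero => simp
    | succ k ih =>
      have := hstep _ ih
      push_cast
      rw [← add_assoc]; exact this
  have hmem : ∀ k : ℕ, m + (k : ℤ) ∈ S := by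
    intro k; by_contra h
    have := h0 _ h
    rw [hev k] at this; linarith
  have hinf : Set.Infinite (S : Set ℤ) :=
    Set.infinite_of_injective_forall_mem (f := fun k : ℕ => m + (k : ℤ))
      (fun a b h => by simpa using h) (fun k => by simpa using hmem k)
  exact hinf S.finite_toSet

theorem harmonic_eq_zero {q : ℝ} (hq : 0 ≤ q) (S : Finset ℤ) (g : ℤ → ℝ)
    (h0 : ∀ x ∉ S, g x = 0)
    (h1 : ∀ x ∈ S, g x = q / (1 + q) * g (x - 1) + 1 / (1 + q) * g (x + 1)) (x : ℤ) :
    g x = 0 := by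
  refine le_antisymm (harmonic_le_zero hq S g (fun x hx => (h0 x hx).le) h1 x) ?_
  have := harmonic_le_zero hq S (fun z => -g z) (fun x hx => by simp [h0 x hx])
    (fun x hx => by rw [h1 x hx]; ring) x
  linarith

theorem dropAvg_lin (q : ℝ) (x : ℤ) (f g h : Finset ℤ → ℝ) (a b : ℝ) (S : Finset ℤ)
    (hf : ∀ y, f (insert y S) = a * g (insert y S) + b * h (insert y S)) :
    dropAvg q x f S = a * dropAvg q x g S + b * dropAvg q x h S := by
  rw [dropAvg_eq_sum q x f S _ subset_rfl, dropAvg_eq_sum q x g S _ subset_rfl,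
    dropAvg_eq_sum q x h S _ subset_rfl, Finset.mul_sum, Finset.mul_sum,
    ← Finset.sum_add_distrib]
  refine Finset.sum_congr rfl fun y _ => ?_
  rw [hf]; ring

theorem dropAvg_comm {q : ℝ} (hq : 0 ≤ q) (x y : ℤ) (f : Finset ℤ → ℝ) (S : Finset ℤ) :
    dropAvg q x (dropAvg q y f) S = dropAvg q y (dropAvg q x f) S := by
  have har : ∀ a b, a ∈ S → dropAvg q b (dropAvg q a f) S =
      q / (1 + q) * dropAvg q b (dropAvg q (a - 1) f) S
        + 1 / (1 + q) * dropAvg q b (dropAvg q (a + 1) f) S := fun a b ha =>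
    dropAvg_lin q b _ _ _ _ _ S fun z => dropAvg_mem hq a f _ (Finset.mem_insert_of_mem ha)
  have base : ∀ a b, a ∉ S → b ∉ S →
      dropAvg q a (dropAvg q b f) S = dropAvg q b (dropAvg q a f) S := by
    intro a b ha hb
    by_cases hab : a = b
    · rw [hab]
    · rw [dropAvg_notMem q a _ S ha, dropAvg_notMem q b _ S hb,
        dropAvg_notMem q b f _ (by simp [Ne.symm hab, hb]),
        dropAvg_notMem q a f _ (by simp [hab, ha]), Finset.insert_comm]
  have half : ∀ a b, a ∉ S →
      dropAvg q a (dropAvg q b f) S = dropAvg q b (dropAvg q a f) S := by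
    intro a b ha
    rw [← sub_eq_zero]
    refine harmonic_eq_zero hq S
      (fun b => dropAvg q a (dropAvg q b f) S - dropAvg q b (dropAvg q a f) S)
      (fun b hb => sub_eq_zero.2 (base a b ha hb)) (fun b hb => ?_) b
    rw [har b a hb, dropAvg_mem hq b _ S hb]; ring
  rw [← sub_eq_zero]
  refine harmonic_eq_zero hq S
    (fun x => dropAvg q x (dropAvg q y f) S - dropAvg q y (dropAvg q x f) S)
    (fun x hx => sub_eq_zero.2 (half x y hx)) (fun x hx => ?_) x
  rw [har x y hx, dropAvg_mem hq x _ S hx]; ring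

/-- The law of the final set of occupied sites does not depend on the order of the balls. -/
theorem finalProb_perm {q : ℝ} (hq : 0 ≤ q) (T : Finset ℤ) {u v : List ℤ} (h : u.Perm v) :
    finalProb q T u = finalProb q T v := by
  induction h with
  | nil => rfl
  | cons x _ ih => funext S; simp only [finalProb, ih]
  | swap x y l => funext S; exact dropAvg_comm hq y x (finalProb q T l) S
  | trans _ _ ih1 ih2 => exact ih1.trans ih2

/-!
# Corrective series of one-hole cores

For every integer `j` the function `x ↦ [j+x]` on `ℤ` is harmonic for the walk of a ball, because
it is affine in `q^x` (for `q = 1`, affine in `x`). Hence, while the balls are dropped, the product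
of `[j+a]` over the occupied sites `a` is preserved in the mean, and the expectation of `∏ [j+a]`
over the final set equals the product of `[j+a]` over the balls of the core (`finalAvg_prod`).

For a core `(α, 0, β)` drop first one ball at each site of `α` and `β`. This leaves two blocks
separated by the hole `c = ℓ+1`. Each further ball leaves its block at one of the two ends with
the probabilities of the gambler's ruin (`dropAvg_block`). Once the hole is filled the occupied
set stays an interval, so the final set is either one of the intervals `[1-i, n-i]`, with
probability `A_{(0^i,γ,0^{n-s-i})}(q) / [n]!`, or the set `[c-p, c-1] ∪ [c+1, c+r]`, whose
probability is an explicit product (`finalAvg_gapSet_left`, `finalAvg_gapSet_right`). So each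
`∏_{a ∈ MSet(γ)} [j+a]` is a sum over these outcomes (`prod_map_gap_core`).

Multiply by `t^j` and sum over `j ≥ 0`. The interval `[1-i, n-i]` contributes
`[n]! t^i ∑ₓ [n+x choose n] tˣ = [n]! t^i / (t;q)_{n+1}` (`qPoch_mul_binomSeries`); these terms
account for the polynomial subtracted in the corrective series. The set with the hole contributes
`t^{p-ℓ} ∑ₓ [x+p choose p] [x+p+r+1 choose r] tˣ` up to a constant, and `mk_qBinom_mul_qBinom`
finds its numerator over `(t;q)_{n+1}` by induction on `r`. The formula for the remixed Eulerian
numbers is the coefficient of `t^i` in the identity so obtained, by the `q`-binomial theorem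
(`coeff_qPoch`).
-/

/-! ### `q`-integers, `q`-factorials and `q`-binomial coefficients -/

theorem qInt_zero (q : ℝ) : qInt q 0 = 0 := by simp [qInt]

theorem qInt_one (q : ℝ) : qInt q 1 = 1 := by simp [qInt]

theorem qInt_succ (q : ℝ) (n : ℕ) : qInt q (n + 1) = qInt q n + q ^ n := by
  simp [qInt, Finset.sum_range_succ]

theorem qInt_add (q : ℝ) (a b : ℕ) : qInt q (a + b) = qInt q a + q ^ a * qInt q b := by
  induction b with
  | zero => simp [qInt_zero]
  | succ b ih => rw [← add_assoc, qInt_succ, ih, qInt_succ]; ring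

theorem qInt_pos {q : ℝ} (hq : 0 < q) (n : ℕ) : 0 < qInt q (n + 1) := by
  rw [add_comm, qInt_add, qInt_one]
  have : 0 ≤ qInt q n := Finset.sum_nonneg fun k _ => by positivity
  positivity

theorem qFact_zero (q : ℝ) : qFact q 0 = 1 := by simp [qFact]

theorem qFact_succ (q : ℝ) (n : ℕ) : qFact q (n + 1) = qFact q n * qInt q (n + 1) := by
  simp [qFact, Finset.prod_Icc_succ_top]

theorem qFact_pos {q : ℝ} (hq : 0 < q) (n : ℕ) : 0 < qFact q n := by
  induction n with
  | zero => simp [qFact_zero]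
  | succ n ih => rw [qFact_succ]; exact mul_pos ih (qInt_pos hq n)

theorem qBinom_add_left (q : ℝ) (n k : ℕ) :
    qBinom q (n + k) n = qFact q (n + k) / (qFact q n * qFact q k) := by
  simp [qBinom]

theorem qBinom_zero_right {q : ℝ} (hq : 0 < q) (n : ℕ) : qBinom q n 0 = 1 := by
  have := (qFact_pos hq n).ne'
  simp [qBinom, qFact_zero, this]

theorem qBinom_self {q : ℝ} (hq : 0 < q) (n : ℕ) : qBinom q n n = 1 := by
  have := (qFact_pos hq n).ne'
  simp [qBinom, qFact_zero, this]

theorem qBinom_of_lt (q : ℝ) {n k : ℕ} (h : n < k) : qBinom q n k = 0 := by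
  simp [qBinom, h]

theorem qBinom_symm (q : ℝ) {n k : ℕ} (h : k ≤ n) : qBinom q n (n - k) = qBinom q n k := by
  simp only [qBinom, h, Nat.sub_le, if_true, Nat.sub_sub_self h, mul_comm]

theorem qBinom_succ_succ {q : ℝ} (hq : 0 < q) (n k : ℕ) :
    qBinom q (n + 1) (k + 1) = qBinom q n k + q ^ (k + 1) * qBinom q n (k + 1) := by
  rcases lt_trichotomy n k with h | rfl | h
  · simp [qBinom_of_lt q h, qBinom_of_lt q (show n < k + 1 by omega),
      qBinom_of_lt q (show n + 1 < k + 1 by omega)]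
  · simp [qBinom_self hq, qBinom_of_lt q (show n < n + 1 by omega)]
  · obtain ⟨d, rfl⟩ := Nat.exists_eq_add_of_lt h
    rw [show k + d + 1 + 1 = (k + 1) + (d + 1) by ring, qBinom_add_left,
      show k + d + 1 = (k + 1) + d by ring, qBinom_add_left,
      show k + 1 + d = k + (d + 1) by ring, qBinom_add_left,
      show k + 1 + (d + 1) = (k + (d + 1)) + 1 by ring, qFact_succ q (k + (d + 1)),
      show k + (d + 1) + 1 = (k + 1) + (d + 1) by ring, qInt_add q (k + 1) (d + 1),
      qFact_succ q k, qFact_succ q d]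
    have h1 := (qFact_pos hq k).ne'
    have h2 := (qFact_pos hq d).ne'
    have h3 := (qInt_pos hq k).ne'
    have h4 := (qInt_pos hq d).ne'
    field_simp

theorem qBinom_succ_succ' {q : ℝ} (hq : 0 < q) (n k : ℕ) (h : k ≤ n) :
    qBinom q (n + 1) (k + 1) = q ^ (n - k) * qBinom q n k + qBinom q n (k + 1) := by
  rcases h.eq_or_lt with rfl | h
  · simp [qBinom_self hq, qBinom_of_lt q (show k < k + 1 by omega)]
  · have e1 := qBinom_symm q (show k + 1 ≤ n + 1 by omega)
    have e2 := qBinom_symm q (show k ≤ n by omega)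
    have e3 := qBinom_symm q (show k + 1 ≤ n by omega)
    have := qBinom_succ_succ hq n (n - (k + 1))
    rw [show n - (k + 1) + 1 = n + 1 - (k + 1) by omega, e1, e3,
      show n + 1 - (k + 1) = n - k by omega, e2] at this
    rw [this]; ring

theorem qInt_mul_qBinom_succ {q : ℝ} (hq : 0 < q) (n k : ℕ) :
    qInt q (k + 1) * qBinom q (n + 1) (k + 1) = qInt q (n + 1) * qBinom q n k := by
  rcases lt_or_ge n k with h | h
  · simp [qBinom_of_lt q h, qBinom_of_lt q (show n + 1 < k + 1 by omega)]
  · obtain ⟨d, rfl⟩ := Nat.exists_eq_add_of_le h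
    rw [show k + d + 1 = (k + 1) + d by ring, qBinom_add_left, qBinom_add_left,
      show k + 1 + d = k + d + 1 by ring, qFact_succ, qFact_succ]
    have h1 := (qFact_pos hq k).ne'
    have h2 := (qFact_pos hq d).ne'
    have h3 := (qInt_pos hq k).ne'
    field_simp

/-! ### The `q`-binomial theorem and its inverse -/

theorem qPoch_succ (q : ℝ) (n : ℕ) :
    qPoch q (n + 1) = qPoch q n * (1 - PowerSeries.C (q ^ n) * PowerSeries.X) := by
  simp [qPoch, Finset.prod_range_succ]

theorem coeff_qPoch {q : ℝ} (hq : 0 < q) (n k : ℕ) :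
    PowerSeries.coeff k (qPoch q n) = (-1) ^ k * q ^ (k.choose 2) * qBinom q n k := by
  induction n generalizing k with
  | zero =>
    rcases k with _ | k
    · simp [qPoch, qBinom_self hq]
    · simp [qPoch, PowerSeries.coeff_one, qBinom_of_lt q (Nat.succ_pos k)]
  | succ n ih =>
    rw [qPoch_succ, mul_sub, mul_one, map_sub,
      show qPoch q n * (PowerSeries.C (q ^ n) * PowerSeries.X) =
        PowerSeries.C (q ^ n) * (qPoch q n * PowerSeries.X) by ring, PowerSeries.coeff_C_mul]
    rcases k with _ | k
    · simp [ih, qBinom_zero_right hq]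
    · rw [PowerSeries.coeff_succ_mul_X, ih, ih, Nat.choose_succ_succ' k 1, Nat.choose_one_right]
      rcases lt_or_ge n k with h | h
      · simp [qBinom_of_lt q h, qBinom_of_lt q (show n < k + 1 by omega),
          qBinom_of_lt q (show n + 1 < k + 1 by omega)]
      · rw [qBinom_succ_succ' hq n k h]
        obtain ⟨d, rfl⟩ := Nat.exists_eq_add_of_le h
        rw [Nat.add_sub_cancel_left]; ring

/-- The series `∑ₓ [n+x choose n] tˣ`, the inverse of `(t;q)_{n+1}`. -/
noncomputable def binomSeries (q : ℝ) (n : ℕ) : ℝ⟦X⟧ :=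
  PowerSeries.mk fun x => qBinom q (n + x) n

theorem qPoch_mul_binomSeries {q : ℝ} (hq : 0 < q) (n : ℕ) :
    qPoch q (n + 1) * binomSeries q n = 1 := by
  induction n with
  | zero =>
    ext x
    rcases x with _ | x
    · simp [qPoch, binomSeries, sub_mul, qBinom_zero_right hq]
    · simp [qPoch, binomSeries, sub_mul, PowerSeries.coeff_succ_X_mul,
        qBinom_zero_right hq, PowerSeries.coeff_one]
  | succ n ih =>
    suffices h : (1 - PowerSeries.C (q ^ (n + 1)) * PowerSeries.X) * binomSeries q (n + 1) =
        binomSeries q n by rw [qPoch_succ, mul_assoc, h, ih]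
    ext x
    rw [sub_mul, one_mul, map_sub, mul_assoc, PowerSeries.coeff_C_mul]
    rcases x with _ | x
    · simp [binomSeries, qBinom_self hq]
    · simp only [PowerSeries.coeff_succ_X_mul, binomSeries, PowerSeries.coeff_mk]
      rw [show n + 1 + (x + 1) = (n + (x + 1)) + 1 by ring, qBinom_succ_succ hq,
        show n + 1 + x = n + (x + 1) by ring]
      ring

/-! ### The series of a gap set -/

/-- The coefficients of the numerator of `∑ₓ [x+p choose p] [x+p+r+1 choose r] tˣ` over
`(t;q)_{p+r+1}`. The case distinction is needed because `r - i` is truncated. -/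
noncomputable def gapCoeff (q : ℝ) (p r i : ℕ) : ℝ :=
  if i ≤ r then (-1) ^ i * q ^ (p * i + (i + 1).choose 2) * qBinom q (p + r + 1) (r - i) else 0

theorem qInt_mul_gapCoeff_zero {q : ℝ} (hq : 0 < q) (p r : ℕ) :
    qInt q (r + 1) * gapCoeff q p (r + 1) 0 = qInt q (p + r + 2) * gapCoeff q p r 0 := by
  simpa [gapCoeff, add_assoc] using qInt_mul_qBinom_succ hq (p + r + 1) r

/-- The recursion in `r` that `qInt_mul_coeff_X_pow_mul_binomSeries` imposes on the numerators. -/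
theorem qInt_mul_gapCoeff_succ {q : ℝ} (hq : 0 < q) (p r i : ℕ) :
    qInt q (r + 1) * gapCoeff q p (r + 1) (i + 1) =
      qInt q (p + r + 2 + (i + 1)) * gapCoeff q p r (i + 1)
        - q ^ (p + r + 1) * qInt q (i + 1) * gapCoeff q p r i := by
  rcases lt_trichotomy r i with h | rfl | h
  · simp [gapCoeff, show ¬ i ≤ r by omega, show ¬ i + 1 ≤ r by omega]
  · simp [gapCoeff, qBinom_zero_right hq, Nat.choose_succ_succ' (r + 1) 1]
    ring
  · obtain ⟨d, rfl⟩ := Nat.exists_eq_add_of_lt h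
    simp only [gapCoeff, show i + 1 ≤ i + d + 1 + 1 by omega, show i + 1 ≤ i + d + 1 by omega,
      show i ≤ i + d + 1 by omega, if_true, show i + d + 1 + 1 - (i + 1) = d + 1 by omega,
      show i + d + 1 - (i + 1) = d by omega, show i + d + 1 - i = d + 1 by omega,
      Nat.choose_succ_succ' (i + 1) 1, Nat.choose_one_right]
    have e1 := qInt_mul_qBinom_succ hq (p + (i + d + 1) + 1) d
    have e2 := qBinom_succ_succ' hq (p + (i + d + 1) + 1) d (by omega)
    have e3 : qInt q (i + d + 1 + 1) = qInt q (d + 1) + q ^ (d + 1) * qInt q (i + 1) := by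
      rw [← qInt_add]; congr 1; ring
    have e4 := qInt_add q (p + (i + d + 1) + 2) (i + 1)
    rw [show p + (i + d + 1) + 1 - d = p + i + 2 by omega] at e2
    rw [show p + (i + d + 1 + 1) + 1 = p + (i + d + 1) + 1 + 1 by ring, e3, e4, add_mul]
    have e5 : ∀ s : ℝ, qInt q (d + 1) * (s * qBinom q (p + (i + d + 1) + 1 + 1) (d + 1)) =
        s * (qInt q (p + (i + d + 1) + 1 + 1) * qBinom q (p + (i + d + 1) + 1) d) := by
      intro s; rw [← e1]; ring
    rw [e5, e2]
    ring

/-- Multiplying the `x`-th coefficient by `[x+n+2]` maps the span of the series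
`t^i ∑ₓ [n+x choose n] tˣ` to the corresponding span for `n + 1`. -/
theorem qInt_mul_coeff_X_pow_mul_binomSeries {q : ℝ} (hq : 0 < q) (n i x : ℕ) :
    qInt q (x + n + 2) * PowerSeries.coeff x (PowerSeries.X ^ i * binomSeries q n) =
      qInt q (n + 2 + i) * PowerSeries.coeff x (PowerSeries.X ^ i * binomSeries q (n + 1))
      - q ^ (n + 1) * qInt q (i + 1) *
        PowerSeries.coeff x (PowerSeries.X ^ (i + 1) * binomSeries q (n + 1)) := by
  simp only [PowerSeries.coeff_X_pow_mul', binomSeries, PowerSeries.coeff_mk]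
  rcases lt_trichotomy x i with h | rfl | h
  · simp [show ¬ i ≤ x by omega, show ¬ i + 1 ≤ x by omega]
  · simp [qBinom_self hq]
    congr 1; ring
  · obtain ⟨y, rfl⟩ := Nat.exists_eq_add_of_lt h
    simp only [show i ≤ i + y + 1 by omega, show i + 1 ≤ i + y + 1 by omega, if_true,
      show i + y + 1 - i = y + 1 by omega, show i + y + 1 - (i + 1) = y by omega, qBinom_add_left]
    rw [show n + 1 + (y + 1) = (n + 1 + y) + 1 by ring, show n + (y + 1) = n + 1 + y by ring,
      qFact_succ q (n + 1 + y), qFact_succ q n, qFact_succ q y]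
    have h1 := (qFact_pos hq n).ne'
    have h2 := (qFact_pos hq y).ne'
    have h3 := (qInt_pos hq n).ne'
    have h4 := (qInt_pos hq y).ne'
    field_simp
    rw [show i + y + 1 + n + 2 = n + 1 + (i + 1 + (y + 1)) by ring,
      show n + 2 + i = n + 1 + (i + 1) by ring, show n + 1 + y + 1 = n + 1 + (y + 1) by ring,
      qInt_add q (n + 1) (i + 1 + (y + 1)), qInt_add q (n + 1) (i + 1),
      qInt_add q (n + 1) (y + 1), qInt_add q (i + 1) (y + 1)]
    have geom : ∀ k, (q - 1) * qInt q k = q ^ k - 1 := fun k => by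
      rw [mul_comm]; exact geom_sum_mul q k
    linear_combination qFact q (n + 1 + y) * qInt q (y + 1) * q ^ (n + 1) *
      (qInt q (i + 1) * geom (n + 1) - qInt q (n + 1) * geom (i + 1))

/-- The generating series of `[x+p choose p] [x+p+r+1 choose r]`, that is, up to normalization, of
`[x+1]⋯[x+p] [x+p+2]⋯[x+p+r+1]`. -/
theorem mk_qBinom_mul_qBinom {q : ℝ} (hq : 0 < q) (p r : ℕ) :
    PowerSeries.mk (fun x => qBinom q (x + p) p * qBinom q (x + p + r + 1) r) =
      (∑ i ∈ Finset.range (r + 1), PowerSeries.C (gapCoeff q p r i) * PowerSeries.X ^ i) *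
        binomSeries q (p + r) := by
  have coeff_eq : ∀ (s k n x : ℕ), PowerSeries.coeff x
      ((∑ i ∈ Finset.range k, PowerSeries.C (gapCoeff q p s i) * PowerSeries.X ^ i) *
        binomSeries q n) = ∑ i ∈ Finset.range k,
          gapCoeff q p s i * PowerSeries.coeff x (PowerSeries.X ^ i * binomSeries q n) := by
    intro s k n x
    rw [Finset.sum_mul, map_sum]
    exact Finset.sum_congr rfl fun i _ => by rw [mul_assoc, PowerSeries.coeff_C_mul]
  induction r with
  | zero =>
    ext x
    simp [gapCoeff, qBinom_zero_right hq, binomSeries, add_comm]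
  | succ r ih =>
    ext x
    have hr := (qInt_pos hq r).ne'
    apply mul_left_cancel₀ hr
    have ihx := congrArg (PowerSeries.coeff x) ih
    rw [coeff_eq, PowerSeries.coeff_mk] at ihx
    have step := qInt_mul_qBinom_succ hq (x + p + r + 1) r
    set b := fun i => PowerSeries.coeff x (PowerSeries.X ^ i * binomSeries q (p + r + 1)) with hb
    have hlast : gapCoeff q p r (r + 1) = 0 := by simp [gapCoeff]
    calc qInt q (r + 1) * PowerSeries.coeff x
          (PowerSeries.mk fun x => qBinom q (x + p) p * qBinom q (x + p + (r + 1) + 1) (r + 1))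
        = qInt q (x + (p + r) + 2) *
            (qBinom q (x + p) p * qBinom q (x + p + r + 1) r) := by
          rw [PowerSeries.coeff_mk, mul_left_comm, ← add_assoc (x + p), step]
          rw [show x + (p + r) + 2 = x + p + r + 1 + 1 by ring]; ring
      _ = ∑ i ∈ Finset.range (r + 1), (qInt q (p + r + 2 + i) * gapCoeff q p r i * b i
            - q ^ (p + r + 1) * qInt q (i + 1) * gapCoeff q p r i * b (i + 1)) := by
          rw [ihx, Finset.mul_sum]
          refine Finset.sum_congr rfl fun i _ => ?_
          rw [mul_left_comm, qInt_mul_coeff_X_pow_mul_binomSeries hq]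
          simp only [hb]; ring
      _ = ∑ i ∈ Finset.range (r + 2), qInt q (r + 1) * gapCoeff q p (r + 1) i * b i := by
          rw [Finset.sum_sub_distrib, Finset.sum_range_succ' _ (r + 1),
            qInt_mul_gapCoeff_zero hq]
          simp only [qInt_mul_gapCoeff_succ hq, sub_mul, Finset.sum_sub_distrib]
          have shift := (Finset.sum_range_succ
            (fun i => qInt q (p + r + 2 + i) * gapCoeff q p r i * b i) (r + 1)).symm.trans
            (Finset.sum_range_succ' _ _)
          simp only [hlast, mul_zero, zero_mul, add_zero] at shift
          rw [shift]
          ring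
      _ = _ := by
          rw [coeff_eq, Finset.mul_sum]
          exact Finset.sum_congr rfl fun i _ => by rw [mul_assoc]; rfl

/-! ### `q`-integers indexed by `ℤ` -/

/-- The `q`-integer `[x] = (1 - q^x)/(1 - q)` for `x : ℤ`, with the limit value `x` at `q = 1`. -/
noncomputable def qIntZ (q : ℝ) (x : ℤ) : ℝ := if q = 1 then x else (1 - q ^ x) / (1 - q)

theorem qIntZ_add {q : ℝ} (hq : 0 < q) (x y : ℤ) :
    qIntZ q (x + y) = qIntZ q x + q ^ x * qIntZ q y := by
  unfold qIntZ
  split_ifs with h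
  · simp [h]
  · have : 1 - q ≠ 0 := sub_ne_zero.2 (Ne.symm h)
    rw [zpow_add₀ hq.ne']
    field_simp
    ring

theorem qIntZ_zero (q : ℝ) : qIntZ q 0 = 0 := by simp [qIntZ]

theorem qIntZ_one (q : ℝ) : qIntZ q 1 = 1 := by
  unfold qIntZ
  split_ifs with h
  · simp
  · have : 1 - q ≠ 0 := sub_ne_zero.2 (Ne.symm h)
    simp [this]

theorem qIntZ_natCast {q : ℝ} (hq : 0 < q) (n : ℕ) : qIntZ q n = qInt q n := by
  induction n with
  | zero => simp [qIntZ_zero, qInt_zero]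
  | succ n ih => push_cast; rw [qIntZ_add hq, ih, qIntZ_one, qInt_succ]; simp

/-- A function on `ℤ` is harmonic if it is preserved by one move of the ball. -/
def IsHarmonic (q : ℝ) (h : ℤ → ℝ) : Prop :=
  ∀ x, h x = q / (1 + q) * h (x - 1) + 1 / (1 + q) * h (x + 1)

theorem isHarmonic_qIntZ {q : ℝ} (hq : 0 < q) (j : ℤ) : IsHarmonic q fun x => qIntZ q (j + x) := by
  intro x
  have e1 := qIntZ_add hq (j + (x - 1)) 1
  have e2 := qIntZ_add hq (j + x) 1
  rw [show j + (x - 1) + 1 = j + x by ring, qIntZ_one] at e1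
  rw [show j + x + 1 = j + (x + 1) by ring, qIntZ_one] at e2
  have e3 : q ^ (j + x) = q * q ^ (j + (x - 1)) := by
    rw [show j + x = 1 + (j + (x - 1)) by ring, zpow_add₀ hq.ne', zpow_one]
  have : (1 + q) ≠ 0 := by positivity
  field_simp
  linear_combination q * e1 - e2 - e3

/-! ### Expectations of functions of the final set -/

/-- The average of `f` over the final set of occupied sites, when the balls of the list are dropped
one after the other onto the set `S`. -/
noncomputable def finalAvg (q : ℝ) (f : Finset ℤ → ℝ) : List ℤ → Finset ℤ → ℝ
  | [], S => f S
  | x :: u, S => dropAvg q x (finalAvg q f u) S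

theorem finalProb_eq_finalAvg (q : ℝ) (T : Finset ℤ) (u : List ℤ) :
    finalProb q T u = finalAvg q (fun S => if S = T then 1 else 0) u := by
  induction u with
  | nil => rfl
  | cons x u ih => funext S; simp only [finalProb, ih, finalAvg, dropAvg]

theorem finalAvg_append (q : ℝ) (f : Finset ℤ → ℝ) (u v : List ℤ) :
    finalAvg q f (u ++ v) = finalAvg q (finalAvg q f v) u := by
  induction u with
  | nil => rfl
  | cons x u ih => funext S; simp only [List.cons_append, finalAvg, ih]

theorem finalAvg_lin (q : ℝ) (f g : Finset ℤ → ℝ) (a b : ℝ) (u : List ℤ) (S : Finset ℤ) :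
    finalAvg q (fun T => a * f T + b * g T) u S = a * finalAvg q f u S + b * finalAvg q g u S := by
  induction u generalizing S with
  | nil => rfl
  | cons x u ih => exact dropAvg_lin q x _ _ _ a b S fun y => ih _

theorem finalAvg_sum_mul {ι : Type*} (q : ℝ) (s : Finset ι) (f : ι → Finset ℤ → ℝ) (a : ι → ℝ)
    (u : List ℤ) (S : Finset ℤ) :
    finalAvg q (fun T => ∑ i ∈ s, a i * f i T) u S = ∑ i ∈ s, a i * finalAvg q (f i) u S := by
  classical
  induction s using Finset.induction_on with
  | empty =>
    simpa using finalAvg_lin q (fun _ => 0) (fun _ => 0) 0 0 u S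
  | insert i s hi ih =>
    simp only [Finset.sum_insert hi, ← ih]
    simpa using finalAvg_lin q (f i) (fun T => ∑ i ∈ s, a i * f i T) (a i) 1 u S

theorem finalAvg_of_nodup (q : ℝ) (f : Finset ℤ → ℝ) (u : List ℤ) (S : Finset ℤ)
    (hu : u.Nodup) (hS : ∀ x ∈ u, x ∉ S) : finalAvg q f u S = f (u.toFinset ∪ S) := by
  induction u generalizing S with
  | nil => simp [finalAvg]
  | cons x u ih =>
    rw [List.nodup_cons] at hu
    rw [finalAvg, dropAvg_notMem q x _ S (hS x (by simp)), ih _ hu.2]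
    · congr 1; ext; simp
    · intro y hy
      rw [Finset.mem_insert, not_or]
      exact ⟨fun h => hu.1 (h ▸ hy), hS y (by simp [hy])⟩

/-- Optional stopping for one ball: for harmonic `h`, the product of `h` over the occupied sites
has mean its value for the unmoved ball. -/
theorem dropAvg_prod {q : ℝ} (hq : 0 ≤ q) {h : ℤ → ℝ} (hh : IsHarmonic q h) (x : ℤ)
    (S : Finset ℤ) : dropAvg q x (fun T => ∏ a ∈ T, h a) S = h x * ∏ a ∈ S, h a := by
  rw [← sub_eq_zero]
  refine harmonic_eq_zero hq S
    (fun x => dropAvg q x (fun T => ∏ a ∈ T, h a) S - h x * ∏ a ∈ S, h a)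
    (fun x hx => ?_) (fun x hx => ?_) x
  · rw [dropAvg_notMem q x _ S hx, Finset.prod_insert hx, sub_self]
  · rw [dropAvg_mem hq x _ S hx, hh x]; ring

theorem finalAvg_prod {q : ℝ} (hq : 0 ≤ q) {h : ℤ → ℝ} (hh : IsHarmonic q h) (u : List ℤ)
    (S : Finset ℤ) :
    finalAvg q (fun T => ∏ a ∈ T, h a) u S = (u.map h).prod * ∏ a ∈ S, h a := by
  induction u generalizing S with
  | nil => simp [finalAvg]
  | cons x u ih =>
    have := dropAvg_lin q x (finalAvg q (fun T => ∏ a ∈ T, h a) u) (fun T => ∏ a ∈ T, h a)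
      (fun _ => 0) (u.map h).prod 0 S fun y => by rw [ih]; ring
    rw [finalAvg, this, dropAvg_prod hq hh]
    simp; ring

/-! ### Translation invariance -/

theorem landProb_translate (q : ℝ) (c : ℤ) (S : Finset ℤ) (x y : ℤ) :
    landProb q (S.image (· + c)) (x + c) (y + c) = landProb q S x y := by
  have hmem : ∀ x, x + c ∈ S.image (· + c) ↔ x ∈ S := fun x => by simp
  have key : ∀ N x, landWithin q (S.image (· + c)) N (x + c) (y + c) = landWithin q S N x y := by
    intro N
    induction N with
    | zero => intro x; simp only [landWithin, hmem, add_left_inj]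
    | succ N ih =>
      intro x
      have e1 := ih (x - 1)
      have e2 := ih (x + 1)
      rw [show x - 1 + c = x + c - 1 by ring] at e1
      rw [show x + 1 + c = x + c + 1 by ring] at e2
      simp only [landWithin, hmem, add_left_inj, e1, e2]
  simp only [landProb, key]

theorem finalProb_translate (q : ℝ) (c : ℤ) (T : Finset ℤ) (u : List ℤ) (S : Finset ℤ) :
    finalProb q (T.image (· + c)) (u.map (· + c)) (S.image (· + c)) = finalProb q T u S := by
  induction u generalizing S with
  | nil =>
    simp only [List.map_nil, finalProb,
      (Finset.image_injective (add_left_injective c)).eq_iff]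
  | cons x u ih =>
    rw [List.map_cons, finalProb, finalProb, ← (Equiv.addRight c).tsum_eq]
    refine tsum_congr fun y => ?_
    rw [Equiv.coe_addRight, landProb_translate, ← ih, Finset.image_insert]

/-! ### Gambler's ruin -/

/-- A ball dropped on a maximal block `[lo, hi]` of occupied sites leaves it on the left or on the
right with the probabilities of the gambler's ruin. -/
theorem dropAvg_block {q : ℝ} (hq : 0 < q) (f : Finset ℤ → ℝ) (S : Finset ℤ) (lo hi : ℤ)
    (hS : Finset.Icc lo hi ⊆ S) (hlo : lo - 1 ∉ S) (hhi : hi + 1 ∉ S) (a : ℤ)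
    (ha : lo - 1 ≤ a) (ha' : a ≤ hi + 1) :
    qIntZ q (hi - lo + 2) * dropAvg q a f S =
      q ^ (a - lo + 1) * qIntZ q (hi + 1 - a) * f (insert (lo - 1) S) +
        qIntZ q (a - lo + 1) * f (insert (hi + 1) S) := by
  have hsplit : ∀ a, qIntZ q (hi - lo + 2) =
      qIntZ q (a - lo + 1) + q ^ (a - lo + 1) * qIntZ q (hi + 1 - a) := fun a => by
    rw [← qIntZ_add hq]; congr 1; ring
  -- Eliminating the power of `q` makes the right side visibly harmonic in `a`.
  have hpow : ∀ a, q ^ (a - lo + 1) * qIntZ q (hi + 1 - a) =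
      qIntZ q (hi - lo + 2) - qIntZ q (a - lo + 1) := fun a => by rw [hsplit a]; ring
  set g : ℤ → ℝ := fun a => qIntZ q (hi - lo + 2) * dropAvg q a f S -
      ((qIntZ q (hi - lo + 2) - qIntZ q (a - lo + 1)) * f (insert (lo - 1) S) +
        qIntZ q (a - lo + 1) * f (insert (hi + 1) S)) with hg
  suffices g a = 0 by rw [hpow]; simp only [hg] at this; linarith
  have hgl : g (lo - 1) = 0 := by
    simp only [hg, dropAvg_notMem q _ f S hlo]
    rw [show lo - 1 - lo + 1 = 0 by ring, qIntZ_zero]; ring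
  have hgh : g (hi + 1) = 0 := by
    simp only [hg, dropAvg_notMem q _ f S hhi]
    rw [show hi + 1 - lo + 1 = hi - lo + 2 by ring]; ring
  have hgharm : ∀ x ∈ Finset.Icc lo hi,
      g x = q / (1 + q) * g (x - 1) + 1 / (1 + q) * g (x + 1) := by
    intro x hx
    have e := isHarmonic_qIntZ hq (1 - lo) x
    simp only [show ∀ z : ℤ, 1 - lo + z = z - lo + 1 from fun z => by ring] at e
    have e1 : q / (1 + q) + 1 / (1 + q) = 1 := by field_simp; ring
    simp only [hg, dropAvg_mem hq.le x f S (hS hx)]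
    linear_combination (f (insert (lo - 1) S) - f (insert (hi + 1) S)) * e +
      qIntZ q (hi - lo + 2) * f (insert (lo - 1) S) * e1
  have := harmonic_eq_zero hq.le (Finset.Icc lo hi)
    (fun x => if lo - 1 ≤ x ∧ x ≤ hi + 1 then g x else 0) (fun x hx => ?_) (fun x hx => ?_) a
  · simpa [ha, ha'] using this
  · split_ifs with h
    · rw [Finset.mem_Icc] at hx
      obtain rfl | rfl : x = lo - 1 ∨ x = hi + 1 := by omega
      exacts [hgl, hgh]
    · rfl
  · have hx' := Finset.mem_Icc.1 hx
    rw [if_pos (by omega), if_pos (by omega), if_pos (by omega)]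
    exact hgharm x hx

theorem qIntZ_pos {q : ℝ} (hq : 0 < q) {x : ℤ} (hx : 0 < x) : 0 < qIntZ q x := by
  obtain ⟨n, rfl⟩ : ∃ n : ℕ, x = ((n + 1 : ℕ) : ℤ) := ⟨(x - 1).toNat, by omega⟩
  rw [qIntZ_natCast hq]; exact qInt_pos hq n

/-- Balls dropped on an interval produce an interval: the mean of a function that vanishes on the
possible final intervals is zero. -/
theorem finalAvg_Icc_eq_zero {q : ℝ} (hq : 0 < q) (f : Finset ℤ → ℝ) (u : List ℤ) (lo hi : ℤ)
    (hne : lo ≤ hi + 1) (hu : ∀ x ∈ u, lo ≤ x ∧ x ≤ hi)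
    (hf : ∀ lo' hi', lo' ≤ lo → hi ≤ hi' → hi' - lo' = hi - lo + u.length →
      f (Finset.Icc lo' hi') = 0) :
    finalAvg q f u (Finset.Icc lo hi) = 0 := by
  induction u generalizing lo hi with
  | nil => exact hf lo hi le_rfl le_rfl (by simp)
  | cons x u ih =>
    obtain ⟨h1, h2⟩ := hu x (by simp)
    have hpos := qIntZ_pos hq (show 0 < hi - lo + 2 by omega)
    have e := dropAvg_block hq (finalAvg q f u) (Finset.Icc lo hi) lo hi subset_rfl (by simp)
      (by simp) x (by omega) (by omega)
    rw [show insert (lo - 1) (Finset.Icc lo hi) = Finset.Icc (lo - 1) hi by ext; simp; omega,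
      show insert (hi + 1) (Finset.Icc lo hi) = Finset.Icc lo (hi + 1) by ext; simp; omega,
      ih, ih, mul_zero, mul_zero, add_zero] at e
    · exact (mul_eq_zero.1 e).resolve_left hpos.ne'
    · omega
    · intro y hy; have := hu y (by simp [hy]); omega
    · intro lo' hi' a b c; exact hf lo' hi' a (by omega) (by simp; omega)
    · omega
    · intro y hy; have := hu y (by simp [hy]); omega
    · intro lo' hi' a b c; exact hf lo' hi' (by omega) b (by simp; omega)

/-! ### Two blocks separated by a hole -/

/-- Two blocks of `K` and `M` occupied sites, to the left and to the right of the hole `c`. -/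
noncomputable def gapSet (c : ℤ) (K M : ℕ) : Finset ℤ := Finset.Icc (c - K) (c - 1) ∪
  Finset.Icc (c + 1) (c + M)

theorem insert_gapSet (c : ℤ) (K M : ℕ) :
    insert c (gapSet c K M) = Finset.Icc (c - K) (c + M) := by
  ext; simp [gapSet]; omega

/-- When the hole is to survive, balls dropped on the left block all have to leave it on the
left. A ball at `a` does so from a block of `K` sites with probability
`q^(a-c+K+1) [c-a] / [K+1]`, which is its weight `[c-a] q^(a-(c-1))` times a factor `q^K / [K+1]`
that depends on `K` only. -/
theorem finalAvg_gapSet_left {q : ℝ} (hq : 0 < q) (f : Finset ℤ → ℝ) (c : ℤ) (u : List ℤ)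
    (K M : ℕ) (hu : ∀ x ∈ u, c - K ≤ x ∧ x < c)
    (hf : ∀ lo hi, lo ≤ c - K → c + M ≤ hi → hi - lo + 1 = K + M + u.length →
      f (Finset.Icc lo hi) = 0) :
    qFact q (K + u.length) * q ^ (K.choose 2) * finalAvg q f u (gapSet c K M) =
      qFact q K * q ^ ((K + u.length).choose 2) *
        (u.map fun a => qIntZ q (c - a) * q ^ (a - (c - 1))).prod *
        f (gapSet c (K + u.length) M) := by
  induction u generalizing K with
  | nil => simp [finalAvg]
  | cons x u ih =>
    obtain ⟨h1, h2⟩ := hu x (by simp)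
    have e := dropAvg_block hq (finalAvg q f u) (gapSet c K M) (c - K) (c - 1)
      (by simp [gapSet]) (by simp [gapSet]; omega) (by simp [gapSet]) x (by omega) (by omega)
    have hz : finalAvg q f u (insert (c - 1 + 1) (gapSet c K M)) = 0 := by
      rw [sub_add_cancel, insert_gapSet]
      refine finalAvg_Icc_eq_zero hq f u _ _ (by omega) (fun y hy => ?_) fun lo hi a b d => ?_
      · have := hu y (by simp [hy]); omega
      · exact hf lo hi a b (by simp; omega)
    have hins : insert (c - K - 1) (gapSet c K M) = gapSet c (K + 1) M := by
      ext; simp [gapSet]; omega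
    rw [hz, hins, show c - 1 - (c - K) + 2 = ((K + 1 : ℕ) : ℤ) by push_cast; ring,
      qIntZ_natCast hq, sub_add_cancel, mul_zero, add_zero] at e
    have ih' := ih (K + 1) (fun y hy => by have := hu y (by simp [hy]); push_cast; omega)
      (fun lo hi a b d => hf lo hi (by push_cast at a; omega) b (by push_cast at d ⊢; simp; omega))
    rw [finalAvg, List.length_cons, List.map_cons, List.prod_cons,
      show K + (u.length + 1) = K + 1 + u.length by ring]
    have hpos := (qInt_pos hq K).ne'
    have hpow : q ^ (x - (c - K) + 1) = q ^ K * q ^ (x - (c - 1)) := by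
      rw [← zpow_natCast, ← zpow_add₀ hq.ne']; congr 1; ring
    apply mul_left_cancel₀ hpos
    rw [hpow] at e
    rw [qFact_succ, Nat.choose_succ_succ' K 1, Nat.choose_one_right, pow_add] at ih'
    linear_combination (qFact q (K + 1 + u.length) * q ^ (K.choose 2)) * e +
      qIntZ q (c - x) * q ^ (x - (c - 1)) * ih'

/-- When the hole is to survive, balls dropped on the right block all have to leave it on the
right, which a ball at `b` does from a block of `M` sites with probability `[b-c] / [M+1]`. -/
theorem finalAvg_gapSet_right {q : ℝ} (hq : 0 < q) (f : Finset ℤ → ℝ) (c : ℤ) (u : List ℤ)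
    (K M : ℕ) (hu : ∀ x ∈ u, c < x ∧ x ≤ c + M)
    (hf : ∀ lo hi, lo ≤ c - K → c + M ≤ hi → hi - lo + 1 = K + M + u.length →
      f (Finset.Icc lo hi) = 0) :
    qFact q (M + u.length) * finalAvg q f u (gapSet c K M) =
      qFact q M * (u.map fun b => qIntZ q (b - c)).prod * f (gapSet c K (M + u.length)) := by
  induction u generalizing M with
  | nil => simp [finalAvg]
  | cons x u ih =>
    obtain ⟨h1, h2⟩ := hu x (by simp)
    have e := dropAvg_block hq (finalAvg q f u) (gapSet c K M) (c + 1) (c + M)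
      (by simp [gapSet]) (by simp [gapSet]) (by simp [gapSet]; omega) x (by omega) (by omega)
    have hz : finalAvg q f u (insert (c + 1 - 1) (gapSet c K M)) = 0 := by
      rw [add_sub_cancel_right, insert_gapSet]
      refine finalAvg_Icc_eq_zero hq f u _ _ (by omega) (fun y hy => ?_) fun lo hi a b d => ?_
      · have := hu y (by simp [hy]); omega
      · exact hf lo hi a b (by simp; omega)
    have hins : insert (c + M + 1) (gapSet c K M) = gapSet c K (M + 1) := by
      ext; simp [gapSet]; omega
    rw [hz, hins, show c + M - (c + 1) + 2 = ((M + 1 : ℕ) : ℤ) by push_cast; ring,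
      qIntZ_natCast hq, show x - (c + 1) + 1 = x - c by ring, mul_zero, zero_add] at e
    have ih' := ih (M + 1) (fun y hy => by have := hu y (by simp [hy]); push_cast; omega)
      (fun lo hi a b d => hf lo hi a (by push_cast at b; omega) (by push_cast at d ⊢; simp; omega))
    rw [finalAvg, List.length_cons, List.map_cons, List.prod_cons,
      show M + (u.length + 1) = M + 1 + u.length by ring]
    apply mul_left_cancel₀ (qInt_pos hq M).ne'
    rw [qFact_succ] at ih'
    linear_combination qFact q (M + 1 + u.length) * e + qIntZ q (x - c) * ih'

/-! ### The multiset of a tuple -/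

theorem mset_nil : mset [] = 0 := by simp [mset]

theorem mset_cons (a : ℕ) (c : List ℕ) :
    mset (a :: c) = Multiset.replicate a 1 + (mset c).map (· + 1) := by
  unfold mset
  rw [← Multiset.coe_mapAddMonoidHom, map_sum]
  exact (Fin.sum_univ_succ (n := c.length) fun i : Fin (c.length + 1) =>
    Multiset.replicate ((a :: c).get i) (i.val + 1)).trans (by simp)

theorem mset_append (c d : List ℕ) :
    mset (c ++ d) = mset c + (mset d).map (· + c.length) := by
  induction c with
  | nil => simp [mset_nil]
  | cons a c ih =>
    simp only [List.cons_append, mset_cons, ih, Multiset.map_add, Multiset.map_map,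
      List.length_cons, add_assoc, Function.comp_def]

theorem card_mset (c : List ℕ) : (mset c).card = c.sum := by
  induction c with
  | nil => simp [mset_nil]
  | cons a c ih => simp [mset_cons, ih]

theorem mset_replicate_zero (k : ℕ) : mset (List.replicate k 0) = 0 := by
  rw [← Multiset.card_eq_zero, card_mset]; simp

theorem mset_pad (i : ℕ) (γ : List ℕ) (k : ℕ) : mset (pad i γ k) = (mset γ).map (· + i) := by
  simp [pad, mset_append, mset_replicate_zero]

theorem mem_mset_le {c : List ℕ} {x : ℕ} (hx : x ∈ mset c) : 1 ≤ x ∧ x ≤ c.length := by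
  induction c generalizing x with
  | nil => simp [mset_nil] at hx
  | cons a c ih =>
    rw [mset_cons, Multiset.mem_add, Multiset.mem_map] at hx
    obtain hx | ⟨y, hy, rfl⟩ := hx
    · simp [Multiset.eq_of_mem_replicate hx]
    · have := ih hy; simp; omega

theorem mem_mset_of_pos {c : List ℕ} (hc : 0 ∉ c) {x : ℕ} (h1 : 1 ≤ x) (h2 : x ≤ c.length) :
    x ∈ mset c := by
  induction c generalizing x with
  | nil => simp at h2; omega
  | cons a c ih =>
    rw [List.mem_cons, not_or] at hc
    rw [mset_cons, Multiset.mem_add, Multiset.mem_map, Multiset.mem_replicate]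
    rcases h1.eq_or_lt with rfl | h
    · exact Or.inl ⟨Ne.symm hc.1, rfl⟩
    · exact Or.inr ⟨x - 1, ih hc.2 (by omega) (by simp at h2; omega), by omega⟩

/-- When all entries are positive, one ball can be set aside at each site. -/
theorem exists_mset_eq {c : List ℕ} (hc : 0 ∉ c) :
    ∃ X : Multiset ℕ, mset c = (Finset.Icc 1 c.length).val + X := by
  refine Multiset.le_iff_exists_add.1 (Finset.val_le_iff_val_subset.2 fun x hx => ?_)
  rw [Finset.mem_val, Finset.mem_Icc] at hx
  exact mem_mset_of_pos hc hx.1 hx.2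

theorem mset_gap (α β : List ℕ) :
    mset (α ++ 0 :: β) = mset α + (mset β).map (· + (α.length + 1)) := by
  simp only [mset_append, mset_cons, Multiset.replicate_zero, zero_add, Multiset.map_map,
    Function.comp_def, add_assoc, add_comm 1]

theorem coe_leftToRight (c : List ℕ) :
    (leftToRight c : Multiset ℤ) = (mset c).map (fun a : ℕ => (a : ℤ)) := by
  rw [leftToRight, ← Multiset.map_coe, Multiset.sort_eq]

/-! ### Remixed Eulerian numbers of shifted cores -/

theorem remixedEulerian_pad {q : ℝ} (hq : 0 ≤ q) (γ : List ℕ) (i k n : ℕ)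
    (hn : i + γ.length + k = n) :
    remixedEulerian q (pad i γ k) =
      qFact q n * finalProb q (Finset.Icc (1 - (i : ℤ)) (n - i)) (leftToRight γ) ∅ := by
  have hlen : (pad i γ k).length = n := by simp [pad]; omega
  have himg : Finset.Icc (1 : ℤ) n = (Finset.Icc (1 - (i : ℤ)) (n - i)).image (· + (i : ℤ)) := by
    rw [Finset.image_add_right_Icc]; simp
  have hperm : (leftToRight (pad i γ k)).Perm ((leftToRight γ).map (· + (i : ℤ))) := by
    rw [← Multiset.coe_eq_coe, coe_leftToRight, mset_pad, ← Multiset.map_coe, coe_leftToRight,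
      Multiset.map_map, Multiset.map_map]
    simp
  rw [remixedEulerian, hlen, finalProb_perm hq _ hperm, himg,
    ← finalProb_translate q (i : ℤ) (Finset.Icc (1 - (i : ℤ)) (n - i)), Finset.image_empty]

/-- The left weights of one ball at each of `ℓ` sites. -/
theorem prod_leftWeight {q : ℝ} (hq : 0 < q) (ℓ : ℕ) :
    (∏ a ∈ Finset.Icc 1 ℓ, qInt q (ℓ + 1 - a) * q ^ ((a : ℤ) - ℓ)) * q ^ (ℓ.choose 2) =
      qFact q ℓ := by
  have reflect : ∏ a ∈ Finset.Icc 1 ℓ, qInt q (ℓ + 1 - a) * q ^ ((a : ℤ) - ℓ) =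
      ∏ i ∈ Finset.range ℓ, qInt q (i + 1) * (q ^ i)⁻¹ := by
    refine Finset.prod_nbij' (fun a => ℓ - a) (fun i => ℓ - i) ?_ ?_ ?_ ?_ ?_
    · intro a ha; simp at ha ⊢; omega
    · intro a ha; simp at ha ⊢; omega
    · intro a ha; simp at ha ⊢; omega
    · intro a ha; simp at ha ⊢; omega
    · intro a ha
      rw [Finset.mem_Icc] at ha
      rw [show ℓ + 1 - a = ℓ - a + 1 by omega, ← zpow_natCast, ← zpow_neg, Nat.cast_sub ha.2,
        neg_sub]
  rw [reflect]
  clear reflect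
  induction ℓ with
  | zero => simp [qFact_zero]
  | succ n ih =>
    rw [Finset.prod_range_succ, Nat.choose_succ_succ' n 1, Nat.choose_one_right, pow_add,
      qFact_succ, ← ih]
    field_simp

/-! ### The law of the final set of a one-hole core, tested against harmonic products -/

/-- The product of `h` over a set, replaced by zero at the intervals `[1-i, n-i]` with `i < k`.
It is encoded as an explicit linear combination, so that averages can be taken term by term. -/
noncomputable def awayFromIntervals (h : ℤ → ℝ) (n k : ℕ) (T : Finset ℤ) : ℝ :=
  1 * ∏ a ∈ T, h a + (-1) * ∑ i ∈ Finset.range k, (∏ a ∈ Finset.Icc (1 - (i : ℤ)) (n - i), h a) *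
    if T = Finset.Icc (1 - (i : ℤ)) (n - i) then 1 else 0

theorem awayFromIntervals_Icc (h : ℤ → ℝ) (n k : ℕ) (lo hi : ℤ) (h1 : lo ≤ 1) (h2 : 1 - lo < k)
    (h3 : hi - lo + 1 = n) (hn : 0 < n) : awayFromIntervals h n k (Finset.Icc lo hi) = 0 := by
  obtain ⟨i, hi'⟩ : ∃ i : ℕ, lo = 1 - i := ⟨(1 - lo).toNat, by omega⟩
  obtain rfl : hi = n - i := by omega
  subst hi'
  rw [awayFromIntervals, Finset.sum_eq_single_of_mem i (Finset.mem_range.2 (by omega))]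
  · simp
  · intro b _ hb
    rw [if_neg, mul_zero]
    intro he
    have hm : (1 - (i : ℤ)) ∈ Finset.Icc (1 - (b : ℤ)) (n - b) :=
      he ▸ Finset.mem_Icc.2 (by omega)
    have hm' : (1 - (b : ℤ)) ∈ Finset.Icc (1 - (i : ℤ)) (n - i) :=
      he ▸ Finset.mem_Icc.2 (by omega)
    rw [Finset.mem_Icc] at hm hm'
    omega

theorem awayFromIntervals_of_notMem (h : ℤ → ℝ) (n k : ℕ) (T : Finset ℤ) (c : ℤ) (hc : c ∉ T)
    (h1 : 1 ≤ c) (h2 : c + k ≤ n + 1) : awayFromIntervals h n k T = ∏ a ∈ T, h a := by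
  rw [awayFromIntervals, Finset.sum_eq_zero]
  · simp
  · intro i hi
    rw [Finset.mem_range] at hi
    rw [if_neg, mul_zero]
    rintro rfl
    exact hc (Finset.mem_Icc.2 (by omega))

/-- The mean of `awayFromIntervals h n k` over the final set, computed in two ways: by optional
stopping, and from the probability of the only final set with a hole. -/
theorem prod_map_gap_core {q : ℝ} (hq : 0 < q) {h : ℤ → ℝ} (hh : IsHarmonic q h) {α β : List ℕ}
    (hα : 0 ∉ α) (hβ : 0 ∉ β) {n k : ℕ} (hn : α.sum + β.sum = n)
    (hk : k + α.length + β.length = n) (hn0 : 0 < n) :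
    qFact q α.sum * qFact q β.sum *
      (((mset (α ++ 0 :: β)).map fun a : ℕ => h a).prod -
        ∑ i ∈ Finset.range k, (∏ a ∈ Finset.Icc (1 - (i : ℤ)) (n - i), h a) *
          finalProb q (Finset.Icc (1 - (i : ℤ)) (n - i)) (leftToRight (α ++ 0 :: β)) ∅) =
      q ^ (α.sum.choose 2) *
        ((mset α).map fun a => qInt q (α.length + 1 - a) * q ^ ((a : ℤ) - α.length)).prod *
        ((mset β).map fun b => qInt q b).prod *
        ∏ a ∈ gapSet (α.length + 1) α.sum β.sum, h a := by
  obtain ⟨X, hX⟩ := exists_mset_eq hα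
  obtain ⟨Y, hY⟩ := exists_mset_eq hβ
  have hXm : ∀ a ∈ X, 1 ≤ a ∧ a ≤ α.length := fun a ha => mem_mset_le (by rw [hX]; simp [ha])
  have hYm : ∀ a ∈ Y, 1 ≤ a ∧ a ≤ β.length := fun a ha => mem_mset_le (by rw [hY]; simp [ha])
  have hXc : α.length + X.card = α.sum := by rw [← card_mset α, hX]; simp
  have hYc : β.length + Y.card = β.sum := by rw [← card_mset β, hY]; simp
  set c : ℤ := α.length + 1 with hc
  set l₀ : List ℤ := (Finset.Icc 1 α.length).toList.map (fun a : ℕ => (a : ℤ)) ++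
    (Finset.Icc 1 β.length).toList.map (fun b : ℕ => (b : ℤ) + c) with hl₀
  set l₁ : List ℤ := X.toList.map (fun a : ℕ => (a : ℤ)) with hl₁
  set l₂ : List ℤ := Y.toList.map (fun b : ℕ => (b : ℤ) + c) with hl₂
  have hl₁m : ∀ x ∈ l₁, 1 ≤ x ∧ x < c := by
    intro x hx
    obtain ⟨a, ha, rfl⟩ := List.mem_map.1 hx
    have := hXm a (Multiset.mem_toList.1 ha); omega
  have hl₂m : ∀ x ∈ l₂, c < x ∧ x ≤ c + β.length := by
    intro x hx
    obtain ⟨a, ha, rfl⟩ := List.mem_map.1 hx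
    have := hYm a (Multiset.mem_toList.1 ha); omega
  have hl₁c : l₁.length = X.card := by simp [hl₁]
  have hl₂c : l₂.length = Y.card := by simp [hl₂]
  have hperm : (leftToRight (α ++ 0 :: β)).Perm (l₀ ++ (l₁ ++ l₂)) := by
    rw [← Multiset.coe_eq_coe, coe_leftToRight, mset_gap, hX, hY, hl₀, hl₁, hl₂]
    simp only [← Multiset.coe_add, ← Multiset.map_coe, Multiset.coe_toList, Finset.coe_toList,
      Multiset.map_add, Multiset.map_map, Function.comp_def, Nat.cast_add, Nat.cast_one, hc]
    abel
  have hnodup : l₀.Nodup := by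
    refine List.Nodup.append ((Finset.nodup_toList _).map fun a b h => by simpa using h)
      ((Finset.nodup_toList _).map fun a b h => by simpa using h) ?_
    intro x hx hx'
    simp only [List.mem_map, Finset.mem_toList, Finset.mem_Icc] at hx hx'
    omega
  -- The balls of `l₀` fill the sites of `α` and `β`; those of `l₁` and `l₂` fall on full blocks.
  have hset : l₀.toFinset ∪ ∅ = gapSet c α.length β.length := by
    ext x
    simp only [hl₀, gapSet, Finset.union_empty, List.mem_toFinset, List.mem_append, List.mem_map,
      Finset.mem_toList, Finset.mem_union, Finset.mem_Icc]
    constructor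
    · rintro (⟨a, ha, rfl⟩ | ⟨a, ha, rfl⟩) <;> omega
    · rintro (h | h)
      · exact Or.inl ⟨x.toNat, by omega⟩
      · exact Or.inr ⟨(x - c).toNat, by omega⟩
  set f := awayFromIntervals h n k with hf
  have hfI : ∀ lo hi : ℤ, lo ≤ 1 → c + β.length ≤ hi → hi - lo + 1 = n →
      f (Finset.Icc lo hi) = 0 := fun lo hi h1 h2 h3 =>
    awayFromIntervals_Icc h n k lo hi h1 (by omega) h3 hn0
  -- The mean of `f` by optional stopping.
  have mean₁ : finalAvg q f (l₀ ++ (l₁ ++ l₂)) ∅ =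
      ((mset (α ++ 0 :: β)).map fun a : ℕ => h a).prod -
        ∑ i ∈ Finset.range k, (∏ a ∈ Finset.Icc (1 - (i : ℤ)) (n - i), h a) *
          finalProb q (Finset.Icc (1 - (i : ℤ)) (n - i)) (leftToRight (α ++ 0 :: β)) ∅ := by
    have e : ((l₀ ++ (l₁ ++ l₂)).map h).prod =
        ((mset (α ++ 0 :: β)).map fun a : ℕ => h a).prod := by
      rw [← (hperm.map h).prod_eq, ← Multiset.prod_coe, ← Multiset.map_coe, coe_leftToRight,
        Multiset.map_map]
      rfl
    simp only [finalProb_perm hq.le _ hperm, finalProb_eq_finalAvg, hf]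
    rw [← finalAvg_sum_mul, ← e]
    have := finalAvg_lin q (fun T => ∏ a ∈ T, h a) (fun T => ∑ i ∈ Finset.range k,
      (∏ a ∈ Finset.Icc (1 - (i : ℤ)) (n - i), h a) *
        if T = Finset.Icc (1 - (i : ℤ)) (n - i) then 1 else 0) 1 (-1) (l₀ ++ (l₁ ++ l₂)) ∅
    rw [finalAvg_prod hq.le hh, Finset.prod_empty] at this
    refine Eq.trans this ?_
    ring
  -- The mean of `f` from the probability that the hole survives.
  have hF : ∀ lo hi : ℤ, lo ≤ c - α.length → c + β.length ≤ hi →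
      hi - lo + 1 = α.length + β.length + l₁.length →
      finalAvg q f l₂ (Finset.Icc lo hi) = 0 := by
    intro lo hi h1 h2 h3
    refine finalAvg_Icc_eq_zero hq f l₂ lo hi (by omega) (fun x hx => ?_) fun lo' hi' a b d => ?_
    · have := hl₂m x hx; omega
    · exact hfI lo' hi' (by omega) (by omega) (by omega)
  have stepL := finalAvg_gapSet_left hq (finalAvg q f l₂) c l₁ α.length β.length
    (fun x hx => by have := hl₁m x hx; omega) hF
  have stepR := finalAvg_gapSet_right hq f c l₂ α.sum β.length hl₂m
    (fun lo hi h1 h2 h3 => hfI lo hi (by omega) (by omega) (by omega))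
  rw [hl₁c, hXc] at stepL
  rw [hl₂c, hYc, hf, awayFromIntervals_of_notMem h n k _ c (by simp [gapSet]) (by omega)
    (by omega), ← hf] at stepR
  rw [← mean₁, finalAvg_append, finalAvg_of_nodup q _ l₀ ∅ hnodup (by simp), hset,
    finalAvg_append]
  have hw : ((mset α).map fun a => qInt q (α.length + 1 - a) * q ^ ((a : ℤ) - α.length)).prod *
      q ^ (α.length.choose 2) =
      qFact q α.length * (l₁.map fun a => qIntZ q (c - a) * q ^ (a - (c - 1))).prod := by
    rw [hX, Multiset.map_add, Multiset.prod_add, hl₁, List.map_map,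
      ← Multiset.prod_coe (List.map _ _), ← Multiset.map_coe, Multiset.coe_toList,
      mul_right_comm]
    congr 1
    · exact prod_leftWeight hq α.length
    · refine congrArg Multiset.prod (Multiset.map_congr rfl fun a ha => ?_)
      have := hXm a ha
      simp only [Function.comp_apply, hc, add_sub_cancel_right]
      rw [← qIntZ_natCast hq, Nat.cast_sub (by omega)]
      push_cast; rfl
  have hv : ((mset β).map fun b => qInt q b).prod =
      qFact q β.length * (l₂.map fun b => qIntZ q (b - c)).prod := by
    rw [hY, Multiset.map_add, Multiset.prod_add, hl₂, List.map_map,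
      ← Multiset.prod_coe (List.map _ _), ← Multiset.map_coe, Multiset.coe_toList]
    simp [qIntZ_natCast hq, qFact]
  apply mul_left_cancel₀ (pow_pos hq (α.length.choose 2)).ne'
  rw [hv]
  linear_combination qFact q β.sum * stepL + q ^ (α.sum.choose 2) * qFact q α.length *
    (l₁.map fun a => qIntZ q (c - a) * q ^ (a - (c - 1))).prod * stepR -
    q ^ (α.sum.choose 2) * qFact q β.length * (l₂.map fun b => qIntZ q (b - c)).prod *
    (∏ a ∈ gapSet c α.sum β.sum, h a) * hw

/-! ### Products of `q`-integers over blocks -/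

theorem prod_qIntZ_Icc {q : ℝ} (hq : 0 < q) (j b : ℤ) (x n : ℕ) (hx : j + b = x) :
    qFact q x * ∏ a ∈ Finset.Icc (b + 1) (b + n), qIntZ q (j + a) = qFact q (x + n) := by
  induction n with
  | zero => simp
  | succ n ih =>
    have : Finset.Icc (b + 1) (b + (n + 1 : ℕ)) =
        insert (b + n + 1) (Finset.Icc (b + 1) (b + n)) := by ext; simp; omega
    rw [this, Finset.prod_insert (by simp), mul_left_comm, ih, ← add_assoc x, qFact_succ,
      show j + (b + n + 1) = ((x + n + 1 : ℕ) : ℤ) by push_cast; omega, qIntZ_natCast hq]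
    ring

theorem prod_qIntZ_interval {q : ℝ} (hq : 0 < q) (j i n : ℕ) (hi : i ≤ n) :
    ∏ a ∈ Finset.Icc (1 - (i : ℤ)) (n - i), qIntZ q (j + a) =
      qFact q n * PowerSeries.coeff j (PowerSeries.X ^ i * binomSeries q n) := by
  rw [PowerSeries.coeff_X_pow_mul']
  split_ifs with h
  · obtain ⟨x, rfl⟩ := Nat.exists_eq_add_of_le h
    have := prod_qIntZ_Icc hq ((i + x : ℕ) : ℤ) (-(i : ℤ)) x n (by push_cast; ring)
    rw [show -(i : ℤ) + 1 = 1 - i by ring, show -(i : ℤ) + n = n - i by ring] at this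
    have h1 := (qFact_pos hq n).ne'
    have h2 := (qFact_pos hq x).ne'
    rw [binomSeries, PowerSeries.coeff_mk, Nat.add_sub_cancel_left, qBinom_add_left, add_comm n x,
      ← this]
    field_simp
  · -- The interval contains the zero `-j` of the factor `[j+a]`.
    rw [mul_zero]
    refine Finset.prod_eq_zero (i := -(j : ℤ)) (Finset.mem_Icc.2 (by omega)) ?_
    rw [add_neg_cancel, qIntZ_zero]

theorem prod_qIntZ_gapSet {q : ℝ} (hq : 0 < q) (j l p r : ℕ) (hl : l ≤ p) :
    ∏ a ∈ gapSet (l + 1) p r, qIntZ q (j + a) =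
      qFact q p * qFact q r * PowerSeries.coeff j (PowerSeries.X ^ (p - l) *
        PowerSeries.mk fun x => qBinom q (x + p) p * qBinom q (x + p + r + 1) r) := by
  rw [PowerSeries.coeff_X_pow_mul']
  split_ifs with h
  · obtain ⟨x, rfl⟩ := Nat.exists_eq_add_of_le h
    have e1 := prod_qIntZ_Icc hq ((p - l + x : ℕ) : ℤ) (l - p) x p (by push_cast [hl]; ring)
    have e2 := prod_qIntZ_Icc hq ((p - l + x : ℕ) : ℤ) (l + 1) (x + p + 1) r
      (by push_cast [hl]; ring)
    have h1 := (qFact_pos hq p).ne'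
    have h2 := (qFact_pos hq x).ne'
    have h3 := (qFact_pos hq r).ne'
    have h4 := (qFact_pos hq (x + p + 1)).ne'
    rw [gapSet, Finset.prod_union
      (Finset.disjoint_left.2 fun a ha hb => by rw [Finset.mem_Icc] at ha hb; omega),
      show (l : ℤ) + 1 - p = l - p + 1 by ring, show (l : ℤ) + 1 - 1 = l - p + p by ring]
    simp only [PowerSeries.coeff_mk, Nat.add_sub_cancel_left]
    rw [show x + p + r + 1 = r + (x + p + 1) by ring, add_comm x p, qBinom_add_left,
      qBinom_add_left, add_comm p x, add_comm r, ← e1, ← e2]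
    field_simp
  · -- The left block contains the zero `-j` of the factor `[j+a]`.
    rw [mul_zero]
    refine Finset.prod_eq_zero (i := -(j : ℤ))
      (Finset.mem_union_left _ (Finset.mem_Icc.2 (by omega))) ?_
    rw [add_neg_cancel, qIntZ_zero]

/-! ### One-hole configurations -/

/-- The generating series of the products `∏ [j+a]` over the balls of a one-hole core: optional
stopping for all the harmonic functions `x ↦ [j+x]` at once. -/
theorem mk_prod_gap_core {q : ℝ} (hq : 0 < q) {α β : List ℕ} (hα : 0 ∉ α) (hβ : 0 ∉ β) {n k : ℕ}
    (hn : α.sum + β.sum = n) (hk : k + α.length + β.length = n) (hn0 : 0 < n)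
    (hl : α.length ≤ α.sum) :
    PowerSeries.mk (fun j => ((mset (α ++ 0 :: β)).map (fun a => qInt q (j + a))).prod) =
      (∑ i ∈ Finset.range k, PowerSeries.C (remixedEulerian q (pad i (α ++ 0 :: β) (k - 1 - i))) *
        PowerSeries.X ^ i) * binomSeries q n +
      PowerSeries.C (q ^ (α.sum.choose 2) *
        ((mset α).map fun a => qInt q (α.length + 1 - a) * q ^ ((a : ℤ) - α.length)).prod *
        ((mset β).map fun b => qInt q b).prod) * (PowerSeries.X ^ (α.sum - α.length) *
        PowerSeries.mk fun x => qBinom q (x + α.sum) α.sum *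
          qBinom q (x + α.sum + β.sum + 1) β.sum) := by
  ext j
  have key := prod_map_gap_core hq (isHarmonic_qIntZ hq j) hα hβ hn hk hn0
  rw [prod_qIntZ_gapSet hq j α.length α.sum β.sum hl] at key
  rw [PowerSeries.coeff_mk, map_add, PowerSeries.coeff_C_mul, ← sub_eq_iff_eq_add']
  have hsum : PowerSeries.coeff j ((∑ i ∈ Finset.range k, PowerSeries.C
      (remixedEulerian q (pad i (α ++ 0 :: β) (k - 1 - i))) * PowerSeries.X ^ i) *
        binomSeries q n) =
      ∑ i ∈ Finset.range k, (∏ a ∈ Finset.Icc (1 - (i : ℤ)) (n - i), qIntZ q (j + a)) *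
        finalProb q (Finset.Icc (1 - (i : ℤ)) (n - i)) (leftToRight (α ++ 0 :: β)) ∅ := by
    rw [Finset.sum_mul, map_sum]
    refine Finset.sum_congr rfl fun i hi => ?_
    rw [Finset.mem_range] at hi
    rw [mul_assoc, PowerSeries.coeff_C_mul, prod_qIntZ_interval hq j i n (by omega),
      remixedEulerian_pad hq.le _ i (k - 1 - i) n (by simp; omega)]
    ring
  have hcast : ∀ a : ℕ, qIntZ q (j + a) = qInt q (j + a) := fun a => by
    rw [← qIntZ_natCast hq]; push_cast; rfl
  simp only [hcast, ← hsum] at key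
  apply mul_left_cancel₀ (mul_pos (qFact_pos hq α.sum) (qFact_pos hq β.sum)).ne'
  linear_combination key

theorem choose_two_add (a b : ℕ) :
    (a + b).choose 2 = a.choose 2 + a * b + b.choose 2 := by
  induction b with
  | zero => simp
  | succ b ih =>
    rw [← add_assoc, Nat.choose_succ_succ' (a + b) 1, Nat.choose_succ_succ' b 1, ih,
      Nat.choose_one_right, Nat.choose_one_right]
    ring

theorem mainTheorem2 (q : ℝ) (hq : 0 < q) (γ α β : List ℕ) (n p r ℓ m : ℕ)
    (hγ : IsOneHoleCore γ) (hαβ : γ = α ++ 0 :: β)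
    (hℓ : α.length = ℓ) (hm : β.length = m)
    (hp : α.sum = p) (hr : β.sum = r) (hn : γ.sum = n) :
    correctiveSeries q γ =
      PowerSeries.X ^ (p - ℓ) *
        PowerSeries.C
          (((mset α).map (fun a => qInt q (ℓ + 1 - a) * q ^ ((a : ℤ) - (ℓ : ℤ)))).prod) *
        PowerSeries.C (((mset β).map (fun b => qInt q b)).prod) *
        ∑ i ∈ Finset.range (r + 1),
          PowerSeries.C ((-1) ^ i * q ^ (p.choose 2 + p * i + (i + 1).choose 2) *
            qBinom q (n + 1) (r - i)) * PowerSeries.X ^ i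
    ∧ ∀ i : ℕ, i ≤ n - ℓ - m - 1 →
      remixedEulerian q (pad i γ (n - ℓ - m - 1 - i)) =
        (∑ j ∈ Finset.range (i + 1),
          (-1) ^ (i + j) * q ^ ((i - j).choose 2) * qBinom q (n + 1) (i - j) *
            ((mset γ).map (fun a => qInt q (j + a))).prod)
        + if p - ℓ ≤ i then
            (-1) ^ (i + p + ℓ + 1) * q ^ (((i + ℓ + 1).choose 2 : ℤ) - (p : ℤ)) *
              ((mset α).map (fun a => qInt q (ℓ + 1 - a) * q ^ ((a : ℤ) - (ℓ : ℤ)))).prod *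
              ((mset β).map (fun b => qInt q b)).prod *
              qBinom q (n + 1) (i + ℓ + 1)
          else 0 := by
  obtain ⟨⟨c, ⟨-, hsum⟩, ⟨i₀, k₀, rfl⟩, -, -⟩, hcount⟩ := hγ
  have hlen : γ.length = ℓ + m + 1 := by simp [hαβ, ← hℓ, ← hm]; ring
  have hnpr : n = p + r := by simp [← hn, hαβ, hp, hr]
  have hs : ℓ + m + 1 ≤ n := by
    simp [pad] at hsum; omega
  have hαβ0 : 0 ∉ α ∧ 0 ∉ β := by
    simp only [hαβ, List.count_append, List.count_cons_self] at hcount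
    exact ⟨List.count_eq_zero.1 (by omega), List.count_eq_zero.1 (by omega)⟩
  have len_le_sum : ∀ l : List ℕ, 0 ∉ l → l.length ≤ l.sum := fun l hl =>
    List.length_le_sum_of_one_le l fun x hx => Nat.one_le_iff_ne_zero.2 fun h => hl (h ▸ hx)
  have hℓp : ℓ ≤ p := hℓ ▸ hp ▸ len_le_sum α hαβ0.1
  set wα := ((mset α).map (fun a => qInt q (ℓ + 1 - a) * q ^ ((a : ℤ) - (ℓ : ℤ)))).prod with hwα
  set wβ := ((mset β).map (fun b => qInt q b)).prod with hwβ
  have main := mk_prod_gap_core hq hαβ0.1 hαβ0.2 (n := n) (k := n - ℓ - m - 1 + 1)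
    (by omega) (by omega) (by omega) (by omega)
  rw [hℓ, hp, hr, mk_qBinom_mul_qBinom hq, ← hnpr, ← hαβ, ← hwα, ← hwβ] at main
  have first : correctiveSeries q γ =
      PowerSeries.X ^ (p - ℓ) * PowerSeries.C wα * PowerSeries.C wβ *
        ∑ i ∈ Finset.range (r + 1),
          PowerSeries.C ((-1) ^ i * q ^ (p.choose 2 + p * i + (i + 1).choose 2) *
            qBinom q (n + 1) (r - i)) * PowerSeries.X ^ i := by
    have hgap : ∑ i ∈ Finset.range (r + 1),
          PowerSeries.C ((-1) ^ i * q ^ (p.choose 2 + p * i + (i + 1).choose 2) *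
            qBinom q (n + 1) (r - i)) * PowerSeries.X ^ i =
        PowerSeries.C (q ^ (p.choose 2)) * ∑ i ∈ Finset.range (r + 1),
          PowerSeries.C (gapCoeff q p r i) * PowerSeries.X ^ i := by
      rw [Finset.mul_sum]
      refine Finset.sum_congr rfl fun i hi => ?_
      rw [gapCoeff, if_pos (Nat.lt_succ_iff.1 (Finset.mem_range.1 hi)), ← mul_assoc, ← map_mul,
        hnpr, add_assoc (p.choose 2), pow_add]
      congr 2; ring
    rw [correctiveSeries, hn, main, hlen, show n - (ℓ + m + 1) = n - ℓ - m - 1 by omega, hgap]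
    simp only [map_mul, Nat.add_sub_cancel]
    linear_combination (∑ i ∈ Finset.range (n - ℓ - m - 1 + 1),
        PowerSeries.C (remixedEulerian q (pad i γ (n - ℓ - m - 1 - i))) * PowerSeries.X ^ i +
      PowerSeries.C (q ^ (p.choose 2)) * PowerSeries.C wα * PowerSeries.C wβ *
        PowerSeries.X ^ (p - ℓ) * ∑ i ∈ Finset.range (r + 1),
          PowerSeries.C (gapCoeff q p r i) * PowerSeries.X ^ i) * qPoch_mul_binomSeries hq n
  refine ⟨first, fun i hi => ?_⟩
  have coeff_sum : ∀ (a : ℕ → ℝ) (N d : ℕ), d < N →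
      PowerSeries.coeff d (∑ i ∈ Finset.range N, PowerSeries.C (a i) * PowerSeries.X ^ i) =
        a d := by
    intro a N d hd
    simp [PowerSeries.coeff_X_pow, hd]
  have hcoeff := congrArg (PowerSeries.coeff i) first
  rw [correctiveSeries, hn, hlen, show n - (ℓ + m + 1) = n - ℓ - m - 1 by omega, map_sub,
    coeff_sum _ _ _ (Nat.lt_succ_iff.2 hi), mul_comm (qPoch q (n + 1)), PowerSeries.coeff_mul,
    Finset.Nat.sum_antidiagonal_eq_sum_range_succ_mk, mul_assoc, mul_assoc,
    PowerSeries.coeff_X_pow_mul', sub_eq_iff_eq_add, ← sub_eq_iff_eq_add'] at hcoeff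
  rw [← hcoeff, sub_eq_add_neg]
  congr 1
  · refine Finset.sum_congr rfl fun j hj => ?_
    obtain ⟨d, rfl⟩ := Nat.exists_eq_add_of_le (Nat.lt_succ_iff.1 (Finset.mem_range.1 hj))
    rw [PowerSeries.coeff_mk, coeff_qPoch hq, Nat.add_sub_cancel_left,
      show j + d + j = 2 * j + d by ring, pow_add (-1 : ℝ) (2 * j), pow_mul]
    ring
  · split_ifs with h
    · obtain ⟨d, rfl⟩ := Nat.exists_eq_add_of_le h
      rw [PowerSeries.coeff_C_mul, PowerSeries.coeff_C_mul, Nat.add_sub_cancel_left,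
        coeff_sum _ _ _ (by omega), show p - ℓ + d + ℓ + 1 = p + d + 1 by omega,
        ← qBinom_symm q (show p + d + 1 ≤ n + 1 by omega),
        show n + 1 - (p + d + 1) = r - d by omega]
      have hexp : ((p + d + 1).choose 2 : ℤ) - p =
          ((p.choose 2 + p * d + (d + 1).choose 2 : ℕ) : ℤ) := by
        rw [add_assoc p, choose_two_add]; push_cast; ring
      have hsign : (-1 : ℝ) ^ (p - ℓ + d + p + ℓ + 1) = -(-1) ^ d := by
        rw [show p - ℓ + d + p + ℓ + 1 = 2 * p + (d + 1) by omega, pow_add, pow_mul]; ring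
      rw [hexp, zpow_natCast, hsign]
      ring
    · simp
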